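/- **Setting.** Let $R$ be an associative ring with unit, not necessarily commutative, let $\mathcal A$ be an alphabet, not necessarily finite, and let $X$ and $Y_\alpha$ ($\alpha\in\mathcal A$) be non-commuting variables, which do not commute with the elements of $R$ either. Let $\tilde R[[X]]$ be the ring of formal power series whose elements are formal, possibly infinite, sums of monomials $\pm r_1Z_1r_2Z_2\cdots r_lZ_lr_{l+1}$ with $r_i\in R$ and $Z_i\in\{X\}\cup\{Y_\alpha\}_{\alpha\in\mathcal A}$, with finitely many monomials for each word $Z_1\cdots Z_l$ (so the component of a series at this word is an element of the $(l+1)$-fold tensor power of $R$ over $\mathbb Z$). If $h\in\tilde R[[X]]$ has no constant term, $f\circ_X h$ denotes the series obtained from $f$ by replacing every occurrence of $X$ in every monomial of $f$ by $h$. Let $\mathcal K\subset\mathbb N_{>0}$ and let $\mathcal A=\bigcup_{k\in\mathcal K}\mathcal A_k$ be a partition into non-empty parts. For each $k\in\mathcal K$ let $M_1^k,\dots,M_k^k$ be matrices with coefficients in $R$, with rows indexed by $\mathcal A_k$ and columns indexed by $\mathcal A$, and put $\tilde M_i^k=J-M_i^k$, where all coefficients of $J$ are $1$. **Theorem.** (1)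 There is exactly one family $V=(g_\alpha)_{\alpha\in\mathcal A}$ and exactly one family $\tilde V=(\tilde g_\alpha)_{\alpha\in\mathcal A}$ of series in $\tilde R[[X]]$ which consist only of monomials of degree at least $1$ in $X$ involving at least one of the variables $Y_\beta$, for which only finitely many members have a non-zero component at any given word, and which satisfy, for all $k\in\mathcal K$ and $\alpha\in\mathcal A_k$, $$g_\alpha=Y_\alpha\bigl(X-(M_1^kV)_\alpha\bigr)\cdots\bigl(X-(M_k^kV)_\alpha\bigr),\qquad \tilde g_\alpha=Y_\alpha\bigl(-X+(\tilde M_1^k\tilde V)_\alpha\bigr)\cdots\bigl(-X+(\tilde M_k^k\tilde V)_\alpha\bigr).$$ With $g=-X+\sum_{\alpha\in\mathcal A}g_\alpha$ and $\tilde g=-X+\sum_{\alpha\in\mathcal A}\tilde g_\alpha$ one has $$g\circ_X\tilde g=\tilde g\circ_Xg=X.$$ (2) (Commutative power series in one variable.) Let $S$ be a commutative ring, $\mathcal K\subset\mathbb N_{>0}$, $l\in S$ and $\beta_{k,j}\in S$ for $1\le j\le k$. If $1\in\mathcal K$, assume that $1+\beta_{1,1}$ and $1+\beta_{1,1}-l$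 are invertible. Then there are unique $g_*,\tilde g_*\in S[[X]]$ without constant term such that $$g_*=\sum_{k\in\mathcal K}\prod_{j=1}^k(X-\beta_{k,j}g_*),\qquad \tilde g_*=\sum_{k\in\mathcal K}\prod_{j=1}^k\bigl(-X+(l-\beta_{k,j})\tilde g_*\bigr),$$ and $g=-X+l\,g_*$ and $\tilde g=-X+l\,\tilde g_*$ satisfy $g(\tilde g(X))=\tilde g(g(X))=X$. (3) (Computing compositional inverses.) Let $h=\sum_{k\ge1}\gamma_kX^k\in S[[X]]$ and let $u\in S$ be invertible. * If $h(uX)=-X+l\,g_*$ for some data as in (2), then $u\,\tilde g(X)=u(-X+l\,\tilde g_*)$ is the (two-sided) compositional inverse of $h$. * If $u\gamma_1=-1$ and $\gamma_2$ is invertible, then $h(uX)=-X+l\,g_*$ for $\mathcal K=\{2,3,4,\dots\}$, for $l$ the coefficient of $X^2$ in $h(uX)$, and for suitable $\beta_{k,j}\in S$. * If $\gamma_1$ and $1+u\gamma_1$ are invertible (whatever $\gamma_2$ is), then $h(uX)=-X+l\,g_*$ for $\mathcal K=\{1,2,3,\dots\}$ and suitable $l,\beta_{k,j}\in S$ such that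 $1+\beta_{1,1}$ and $1+\beta_{1,1}-l$ are invertible. -/

import Mathlib

/-! ### Formal power series in non-commuting variables which do not commute with the scalars -/

/-- The non-commuting variables: `X`, and one variable `Y α` for each element `α` of the
alphabet. -/
inductive Letter (A : Type*) where
  | X : Letter A
  | Y : A → Letter A

/-- The relations expressing that the inclusion of `R` is a unital ring homomorphism. -/
inductive NCPoly.Rel (R A : Type*) [Ring R] :
    FreeAlgebra ℤ (R ⊕ Letter A) → FreeAlgebra ℤ (R ⊕ Letter A) → Prop
  | add (r s : R) : NCPoly.Rel R A (FreeAlgebra.ι ℤ (Sum.inl (r + s)))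
      (FreeAlgebra.ι ℤ (Sum.inl r) + FreeAlgebra.ι ℤ (Sum.inl s))
  | mul (r s : R) : NCPoly.Rel R A (FreeAlgebra.ι ℤ (Sum.inl (r * s)))
      (FreeAlgebra.ι ℤ (Sum.inl r) * FreeAlgebra.ι ℤ (Sum.inl s))
  | one : NCPoly.Rel R A (FreeAlgebra.ι ℤ (Sum.inl 1)) 1

/-- The ring of finite sums of monomials `± r₁ Z₁ r₂ Z₂ ⋯ r_l Z_l r_{l+1}` with `r_i ∈ R` and
letters `Z_i`: the ring freely generated by the ring `R` and the letters, i.e. the free product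
(coproduct of rings) of `R` and the free ring on the letters.  The letters commute neither with
each other nor with `R`. -/
def NCPoly (R A : Type*) [Ring R] : Type _ := RingQuot (NCPoly.Rel R A)

namespace NCPoly

variable {R A : Type*} [Ring R]

noncomputable instance : Ring (NCPoly R A) :=
  inferInstanceAs (Ring (RingQuot (NCPoly.Rel R A)))

noncomputable instance : Algebra ℤ (NCPoly R A) :=
  inferInstanceAs (Algebra ℤ (RingQuot (NCPoly.Rel R A)))

/-- The quotient map from the free ring on the elements of `R` and the letters. -/
noncomputable def mk : FreeAlgebra ℤ (R ⊕ Letter A) →ₐ[ℤ] NCPoly R A :=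
  RingQuot.mkAlgHom ℤ (NCPoly.Rel R A)

lemma mk_rel {a b : FreeAlgebra ℤ (R ⊕ Letter A)} (h : NCPoly.Rel R A a b) :
    (mk a : NCPoly R A) = mk b :=
  RingQuot.mkAlgHom_rel ℤ h

/-- The inclusion of the scalars. -/
noncomputable def C : R →+* NCPoly R A where
  toFun r := mk (FreeAlgebra.ι ℤ (Sum.inl r))
  map_one' := by rw [mk_rel Rel.one, map_one]
  map_mul' r s := by rw [mk_rel (Rel.mul r s), map_mul]
  map_zero' := by
    have h : (mk (FreeAlgebra.ι ℤ (Sum.inl ((0 : R) + 0))) : NCPoly R A) = _ :=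
      mk_rel (Rel.add 0 0)
    rw [map_add, add_zero] at h
    exact left_eq_add.mp h
  map_add' r s := by rw [mk_rel (Rel.add r s), map_add]

/-- A letter as an element of the ring. -/
noncomputable def letter (z : Letter A) : NCPoly R A := mk (FreeAlgebra.ι ℤ (Sum.inr z))

/-- The universal property: a ring homomorphism out of `NCPoly R A` from a ring homomorphism on
`R` and arbitrary values of the letters. -/
noncomputable def lift {T : Type*} [Ring T] (φ : R →+* T) (v : Letter A → T) :
    NCPoly R A →+* T :=
  ((RingQuot.liftAlgHom ℤ (s := NCPoly.Rel R A)
    ⟨FreeAlgebra.lift ℤ (Sum.elim φ v), by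
      intro a b h
      cases h <;> simp⟩ : RingQuot (NCPoly.Rel R A) →ₐ[ℤ] T) : RingQuot (NCPoly.Rel R A) →+* T)

@[simp] lemma lift_C {T : Type*} [Ring T] (φ : R →+* T) (v : Letter A → T) (r : R) :
    lift φ v (C r : NCPoly R A) = φ r := by
  change (RingQuot.liftAlgHom ℤ _) (RingQuot.mkAlgHom ℤ (NCPoly.Rel R A) _) = _
  simp

@[simp] lemma lift_letter {T : Type*} [Ring T] (φ : R →+* T) (v : Letter A → T) (z : Letter A) :
    lift φ v (letter z : NCPoly R A) = v z := by
  change (RingQuot.liftAlgHom ℤ _) (RingQuot.mkAlgHom ℤ (NCPoly.Rel R A) _) = _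
  simp

/-- The monomials `r₁ Z₁ r₂ Z₂ ⋯ r_l Z_l r_{l+1}` with underlying word `Z₁ Z₂ ⋯ Z_l`. -/
def monomials : List (Letter A) → Set (NCPoly R A)
  | [] => Set.range C
  | z :: w => {p | ∃ (r : R), ∃ m ∈ monomials w, p = C r * letter z * m}

/-- The additive group of finite sums of monomials with a given underlying word (it is a copy of
the tensor product over `ℤ` of `l + 1` copies of `R`, for a word of length `l`). -/
noncomputable def wordPart (w : List (Letter A)) : AddSubgroup (NCPoly R A) := AddSubgroup.closure (monomials w)

lemma C_mul_monomials (r : R) {w : List (Letter A)} {m : NCPoly R A} (hm : m ∈ monomials w) :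
    C r * m ∈ monomials w := by
  cases w with
  | nil =>
    obtain ⟨s, rfl⟩ := hm
    exact ⟨r * s, map_mul _ _ _⟩
  | cons z w =>
    obtain ⟨s, m', hm', rfl⟩ := hm
    exact ⟨r * s, m', hm', by rw [map_mul]; simp only [mul_assoc]⟩

lemma monomials_mul {u v : List (Letter A)} {a b : NCPoly R A} (ha : a ∈ monomials u)
    (hb : b ∈ monomials v) : a * b ∈ monomials (u ++ v) := by
  induction u generalizing a with
  | nil =>
    obtain ⟨r, rfl⟩ := ha
    exact C_mul_monomials r hb
  | cons z u ih =>
    obtain ⟨r, m, hm, rfl⟩ := ha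
    exact ⟨r, m * b, ih hm, by simp only [mul_assoc]⟩

lemma wordPart_mul {u v : List (Letter A)} {a b : NCPoly R A} (ha : a ∈ wordPart u)
    (hb : b ∈ wordPart v) : a * b ∈ wordPart (u ++ v) := by
  induction ha using AddSubgroup.closure_induction with
  | mem x hx =>
    induction hb using AddSubgroup.closure_induction with
    | mem y hy => exact AddSubgroup.subset_closure (monomials_mul hx hy)
    | zero => rw [mul_zero]; exact zero_mem _
    | add y z _ _ h1 h2 => rw [mul_add]; exact add_mem h1 h2
    | neg y _ h => rw [mul_neg]; exact neg_mem h
  | zero => rw [zero_mul]; exact zero_mem _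
  | add y z _ _ h1 h2 => rw [add_mul]; exact add_mem h1 h2
  | neg y _ h => rw [neg_mul]; exact neg_mem h

lemma C_mem (r : R) : (C r : NCPoly R A) ∈ wordPart [] := AddSubgroup.subset_closure ⟨r, rfl⟩

lemma letter_mem (z : Letter A) : (letter z : NCPoly R A) ∈ wordPart [z] :=
  AddSubgroup.subset_closure ⟨1, 1, ⟨1, map_one _⟩, by rw [map_one, one_mul, mul_one]⟩

end NCPoly

/-- Families of elements of `S` indexed by the words in the letters `L`. -/
def WordFamily (S L : Type*) : Type _ := List L → S

namespace WordFamily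

variable {S L : Type*} [Ring S]

instance : AddCommGroup (WordFamily S L) := inferInstanceAs (AddCommGroup (List L → S))

/-- The convolution product: the component of `f * g` at a word `w` is the sum of the `f u * g v`
over all decompositions `w = u v`. -/
instance : Mul (WordFamily S L) :=
  ⟨fun f g w => ∑ i ∈ Finset.range (w.length + 1), f (w.take i) * g (w.drop i)⟩

instance : One (WordFamily S L) := ⟨fun w => match w with | [] => 1 | _ :: _ => 0⟩

lemma mul_apply (f g : WordFamily S L) (w : List L) :
    (f * g) w = ∑ i ∈ Finset.range (w.length + 1), f (w.take i) * g (w.drop i) := rfl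

@[simp] lemma add_apply (f g : WordFamily S L) (w : List L) : (f + g) w = f w + g w := rfl

@[simp] lemma neg_apply (f : WordFamily S L) (w : List L) : (-f) w = - f w := rfl

@[simp] lemma zero_apply (w : List L) : (0 : WordFamily S L) w = 0 := rfl

@[simp] lemma one_nil : (1 : WordFamily S L) [] = 1 := rfl

@[simp] lemma one_cons (z : L) (w : List L) : (1 : WordFamily S L) (z :: w) = 0 := rfl

lemma mul_nil (f g : WordFamily S L) : (f * g) [] = f [] * g [] := by
  simp [mul_apply]

/-- The family `u ↦ f (z u)`. -/
def tail (f : WordFamily S L) (z : L) : WordFamily S L := fun u => f (z :: u)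

lemma mul_cons (f g : WordFamily S L) (z : L) (w : List L) :
    (f * g) (z :: w) = f [] * g (z :: w) + (f.tail z * g) w := by
  rw [mul_apply, mul_apply, List.length_cons, Finset.sum_range_succ', add_comm]
  rfl

instance : Ring (WordFamily S L) :=
  { (inferInstance : AddCommGroup (WordFamily S L)) with
    left_distrib := fun f g h => by
      funext w
      simp only [mul_apply, add_apply, mul_add, Finset.sum_add_distrib]
    right_distrib := fun f g h => by
      funext w
      simp only [mul_apply, add_apply, add_mul, Finset.sum_add_distrib]
    zero_mul := fun f => by
      funext w
      simp [mul_apply]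
    mul_zero := fun f => by
      funext w
      simp [mul_apply]
    one_mul := fun f => by
      funext w
      cases w with
      | nil => simp [mul_nil]
      | cons z w =>
        rw [mul_cons, one_nil, one_mul, mul_apply]
        simp [tail]
    mul_one := fun f => by
      funext w
      induction w generalizing f with
      | nil => simp [mul_nil]
      | cons z w ih => rw [mul_cons, ih]; simp [tail]
    mul_assoc := fun f g h => by
      funext w
      induction w generalizing f with
      | nil => simp [mul_nil, mul_assoc]
      | cons z w ih =>
        have key : ((f * g).tail z * h) w
            = f [] * (g.tail z * h) w + ((f.tail z * g) * h) w := by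
          simp only [mul_apply _ h, tail, mul_cons, add_mul, Finset.sum_add_distrib,
            Finset.mul_sum, mul_assoc]
        rw [mul_cons, mul_cons f, mul_cons g, key, mul_nil, ih]
        rw [mul_add, mul_assoc, add_assoc] }

/-- The family concentrated at the empty word. -/
def const (s : S) : WordFamily S L := fun w => match w with | [] => s | _ :: _ => 0

open Classical in
/-- The family concentrated at a word with a single letter. -/
noncomputable def single (z : L) (s : S) : WordFamily S L := fun w => if w = [z] then s else 0

@[simp] lemma const_nil (s : S) : (const s : WordFamily S L) [] = s := rfl

@[simp] lemma const_cons (s : S) (z : L) (w : List L) :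
    (const s : WordFamily S L) (z :: w) = 0 := rfl

lemma single_self (z : L) (s : S) : single z s [z] = s := if_pos rfl

lemma single_of_ne {z : L} {s : S} {w : List L} (h : w ≠ [z]) : single z s w = 0 := if_neg h

lemma const_mul_apply (s : S) (f : WordFamily S L) (w : List L) : ((const s : WordFamily S L) * f) w = s * f w := by
  cases w with
  | nil => rw [mul_nil, const_nil]
  | cons z w =>
    have h : (const s : WordFamily S L).tail z = 0 := rfl
    rw [mul_cons, h, zero_mul, zero_apply, add_zero, const_nil]

lemma const_one : (const 1 : WordFamily S L) = 1 := by
  funext w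
  cases w <;> rfl

lemma const_zero : (const 0 : WordFamily S L) = 0 := by
  funext w
  cases w <;> rfl

lemma const_add (s t : S) : (const (s + t) : WordFamily S L) = const s + const t := by
  funext w
  cases w <;> simp

lemma const_mul (s t : S) : (const (s * t) : WordFamily S L) = const s * const t := by
  funext w
  rw [const_mul_apply]
  cases w <;> simp

end WordFamily

/-- The ring of formal power series: formal, in general infinite, sums of monomials
`± r₁ Z₁ r₂ Z₂ ⋯ r_l Z_l r_{l+1}`, with finitely many monomials for each underlying word
`Z₁ ⋯ Z_l`.  Such a series is given by its components at all words `w`, the component at `w` being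
an arbitrary finite sum of monomials with underlying word `w`. -/
def NCSeries (R A : Type*) [Ring R] : Subring (WordFamily (NCPoly R A) (Letter A)) where
  carrier := {f | ∀ w, f w ∈ NCPoly.wordPart w}
  mul_mem' := by
    intro f g hf hg w
    refine sum_mem fun i _ => ?_
    have h := NCPoly.wordPart_mul (hf (w.take i)) (hg (w.drop i))
    rwa [List.take_append_drop] at h
  one_mem' := by
    intro w
    cases w with
    | nil => rw [WordFamily.one_nil, ← map_one (NCPoly.C)]; exact NCPoly.C_mem 1
    | cons z w => exact zero_mem _
  add_mem' := fun hf hg w => add_mem (hf w) (hg w)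
  zero_mem' := fun w => zero_mem _
  neg_mem' := fun hf w => neg_mem (hf w)

namespace NCSeries

variable {R A : Type*} [Ring R]

/-- The component of a series at a word. -/
def coeff (w : List (Letter A)) (f : NCSeries R A) : NCPoly R A := f.1 w

/-- The constant series. -/
noncomputable def C : R →+* NCSeries R A where
  toFun r := ⟨WordFamily.const (NCPoly.C r), fun w => by
    cases w with
    | nil => exact NCPoly.C_mem r
    | cons z w => exact zero_mem _⟩
  map_one' := Subtype.ext (by simpa using WordFamily.const_one)
  map_zero' := Subtype.ext (by simpa using WordFamily.const_zero)
  map_add' r s := Subtype.ext (by simpa using WordFamily.const_add _ _)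
  map_mul' r s := Subtype.ext (by simpa using WordFamily.const_mul _ _)

/-- A letter as a series. -/
noncomputable def letter (z : Letter A) : NCSeries R A :=
  ⟨WordFamily.single z (NCPoly.letter z), fun w => by
    by_cases h : w = [z]
    · subst h
      rw [WordFamily.single_self]
      exact NCPoly.letter_mem z
    · rw [WordFamily.single_of_ne h]
      exact zero_mem _⟩

/-- The series `X`. -/
noncomputable def X : NCSeries R A := letter Letter.X

/-- The series `Y_α`. -/
noncomputable def Y (α : A) : NCSeries R A := letter (Letter.Y α)

/-- The formal sum of a family of series.  It is meaningful if, for each word, only finitely many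
members of the family have a non-zero component at this word. -/
noncomputable def formalSum {ι : Type*} (v : ι → NCSeries R A) : NCSeries R A :=
  ⟨fun w => ∑ᶠ i, coeff w (v i), fun w =>
    finsum_induction (· ∈ NCPoly.wordPart w) (zero_mem _) (fun _ _ => add_mem)
      (fun i => (v i).2 w)⟩

/-- Substitution of the series `h` for every occurrence of the letter `X` in a finite sum of
monomials; scalars and the letters `Y α` are left unchanged. -/
noncomputable def substHom (h : NCSeries R A) : NCPoly R A →+* NCSeries R A :=
  NCPoly.lift C fun z => match z with
    | Letter.X => h
    | Letter.Y α => Y α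

/-- The composition `f ∘_X h`: replace every occurrence of `X` in every monomial of `f` by the
series `h` and sum the results over all words.  This is meaningful as soon as `h` has no constant
term, see `NCSeries.comp_finite` below. -/
noncomputable def comp (f h : NCSeries R A) : NCSeries R A :=
  formalSum fun u : List (Letter A) => substHom h (coeff u f)

/-! The sum defining the composition is locally finite if `h` has no constant term. -/

lemma coeff_C_mul (r : R) (f : NCSeries R A) (w : List (Letter A)) :
    coeff w (C r * f) = NCPoly.C r * coeff w f :=
  WordFamily.const_mul_apply (NCPoly.C r) f.1 w

lemma exists_of_coeff_mul_ne {f g : NCSeries R A} {w : List (Letter A)} (h : coeff w (f * g) ≠ 0) :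
    ∃ u v, w = u ++ v ∧ coeff u f ≠ 0 ∧ coeff v g ≠ 0 := by
  by_contra! H
  refine h ((WordFamily.mul_apply f.1 g.1 w).trans (Finset.sum_eq_zero fun i _ => ?_))
  by_cases hf : f.1 (w.take i) = 0
  · rw [hf, zero_mul]
  · rw [show g.1 (w.drop i) = 0 from H _ _ (List.take_append_drop i w).symm hf, mul_zero]

lemma substHom_letter (h : NCSeries R A) (z : Letter A) : substHom h (NCPoly.letter z)
    = match z with
      | Letter.X => h
      | Letter.Y α => Y α := NCPoly.lift_letter _ _ _

lemma substHom_monomial_coeff {h : NCSeries R A} (h0 : coeff [] h = 0) {u w : List (Letter A)}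
    {m : NCPoly R A} (hm : m ∈ NCPoly.monomials u) (hw : coeff w (substHom h m) ≠ 0) :
    u.length ≤ w.length ∧ ∀ z ∈ u, z = Letter.X ∨ z ∈ w := by
  induction u generalizing m w with
  | nil => simp
  | cons z u ih =>
    obtain ⟨r, m', hm', rfl⟩ := hm
    rw [map_mul, map_mul, mul_assoc,
      show substHom h (NCPoly.C r) = C r from NCPoly.lift_C _ _ _, coeff_C_mul] at hw
    obtain ⟨w₁, w₂, rfl, hw₁, hw₂⟩ := exists_of_coeff_mul_ne (right_ne_zero_of_mul hw)
    obtain ⟨hl, hz⟩ := ih hm' hw₂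
    rw [substHom_letter] at hw₁
    have hne : w₁ ≠ [] ∧ (z = Letter.X ∨ z ∈ w₁) := by
      cases z with
      | X => exact ⟨fun e => hw₁ (e ▸ h0), Or.inl rfl⟩
      | Y α =>
        have e : w₁ = [Letter.Y α] := by
          by_contra e
          exact hw₁ (WordFamily.single_of_ne e)
        simp [e]
    have := List.length_pos_iff.mpr hne.1
    refine ⟨by simp only [List.length_cons, List.length_append]; omega, fun y hy => ?_⟩
    rcases List.mem_cons.mp hy with rfl | hy
    · exact hne.2.imp_right fun e => List.mem_append_left _ e
    · exact (hz y hy).imp_right fun e => List.mem_append_right _ e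

/-- If `h` has no constant term then all the sums defining `f ∘_X h` are finite. -/
theorem comp_finite (f : NCSeries R A) {h : NCSeries R A} (h0 : coeff [] h = 0)
    (w : List (Letter A)) : {u | coeff w (substHom h (coeff u f)) ≠ 0}.Finite := by
  have hfin : {u : List (Letter A) | u.length ≤ w.length ∧ ∀ z ∈ u, z ∈ Letter.X :: w}.Finite := by
    have hs : {z | z ∈ Letter.X :: w}.Finite := List.finite_toSet _
    have := hs.to_subtype
    refine ((List.finite_length_le {z | z ∈ Letter.X :: w} w.length).image
      (List.map Subtype.val)).subset ?_
    rintro u ⟨hu, hz⟩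
    refine ⟨u.attach.map fun z => ⟨z.1, hz z.1 z.2⟩, by simpa using hu, ?_⟩
    simp
  refine hfin.subset fun u hu => ?_
  by_contra hcon
  refine hu ?_
  have hmem := f.2 u
  change f.1 u ∈ NCPoly.wordPart u at hmem
  change coeff w (substHom h (f.1 u)) = 0
  generalize f.1 u = a at hmem
  induction hmem using AddSubgroup.closure_induction with
  | mem m hm =>
    by_contra hne
    exact hcon (by simpa using substHom_monomial_coeff h0 hm hne)
  | zero => rw [map_zero]; rfl
  | add x y _ _ hx hy =>
    rw [map_add]
    exact (congrArg₂ (· + ·) hx hy).trans (add_zero _)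
  | neg x _ hx =>
    rw [map_neg]
    exact (congrArg Neg.neg hx).trans neg_zero

/-- The coordinate `(M V)_α = ∑_β M(α, β) V_β` of the product of a matrix with a column vector of
series, where rows are indexed by some set and columns by the (possibly infinite) alphabet. -/
noncomputable def mulVec {I : Type*} (M : Matrix I A R) (V : A → NCSeries R A) (α : I) :
    NCSeries R A :=
  formalSum fun β => C (M α β) * V β

/-- The families `(V_α)` of series having only monomials of degree at least one in `X` which
involve at least one of the variables `Y_β`, and such that sums `∑_β M(α, β) V_β` make sense. -/
structure Admissible (V : A → NCSeries R A) : Prop where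
  support : ∀ α w, coeff w (V α) ≠ 0 → Letter.X ∈ w ∧ ∃ β, Letter.Y β ∈ w
  locallyFinite : ∀ w, {α | coeff w (V α) ≠ 0}.Finite

/-- The defining equations of the series `g_α`: for `k ∈ K` and `α ∈ A_k`,
`g_α = Y_α (X - (M_1^k V)_α) (X - (M_2^k V)_α) ⋯ (X - (M_k^k V)_α)`. -/
structure IsDirectSystem {K : Set ℕ} {part : K → Set A}
    (M : (k : K) → Fin k → Matrix (part k) A R) (V : A → NCSeries R A) : Prop
    extends Admissible V where
  eqn : ∀ (k : K) (α : part k),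
    V α = Y (α : A) * (List.ofFn fun i : Fin k => X - mulVec (M k i) V α).prod

/-- The defining equations of the series `g̃_α`: for `k ∈ K` and `α ∈ A_k`,
`g̃_α = Y_α (-X + (M̃_1^k Ṽ)_α) ⋯ (-X + (M̃_k^k Ṽ)_α)` where `M̃_i^k = J - M_i^k` and all
coefficients of `J` are `1`. -/
structure IsComplementarySystem {K : Set ℕ} {part : K → Set A}
    (M : (k : K) → Fin k → Matrix (part k) A R) (V : A → NCSeries R A) : Prop
    extends Admissible V where
  eqn : ∀ (k : K) (α : part k),
    V α = Y (α : A) * (List.ofFn fun i : Fin k =>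
      -X + mulVec ((Matrix.of fun _ _ => 1) - M k i) V α).prod

/-- The series `-X + ∑_α V_α`. -/
noncomputable def total (V : A → NCSeries R A) : NCSeries R A := -X + formalSum V

end NCSeries

/-! ### Commutative power series in one variable -/

/-- The power series `p` is the formal sum of the family `F k`, `k ∈ K`. -/
def IsFormalSum {S : Type*} [CommRing S] (K : Set ℕ) (F : ℕ → PowerSeries S)
    (p : PowerSeries S) : Prop :=
  ∀ n, {k ∈ K | PowerSeries.coeff n (F k) ≠ 0}.Finite ∧
    PowerSeries.coeff n p = ∑ᶠ k ∈ K, PowerSeries.coeff n (F k)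

/-- `p` has no constant term and `p = ∑_{k ∈ K} ∏_{j=1}^k (X - b_{k,j} p)`. -/
def IsStar {S : Type*} [CommRing S] (K : Set ℕ) (b : ℕ → ℕ → S) (p : PowerSeries S) : Prop :=
  PowerSeries.constantCoeff p = 0 ∧
    IsFormalSum K (fun k => ∏ j ∈ Finset.Icc 1 k,
      (PowerSeries.X - PowerSeries.C (b k j) * p)) p

/-- `q` has no constant term and `q = ∑_{k ∈ K} ∏_{j=1}^k (-X + (l - b_{k,j}) q)`. -/
def IsCoStar {S : Type*} [CommRing S] (K : Set ℕ) (l : S) (b : ℕ → ℕ → S)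
    (q : PowerSeries S) : Prop :=
  PowerSeries.constantCoeff q = 0 ∧
    IsFormalSum K (fun k => ∏ j ∈ Finset.Icc 1 k,
      (-PowerSeries.X + PowerSeries.C (l - b k j) * q)) q

/-- The power series `-X + l p`. -/
noncomputable def starTotal {S : Type*} [CommRing S] (l : S) (p : PowerSeries S) :
    PowerSeries S :=
  -PowerSeries.X + PowerSeries.C l * p

/-- The index set `K` consists of positive integers and, in case `1 ∈ K`, the linear terms of the
equations of `IsStar` and `IsCoStar` can be solved. -/
def StarSolvable {S : Type*} [CommRing S] (K : Set ℕ) (l : S) (b : ℕ → ℕ → S) : Prop :=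
  (∀ k ∈ K, 0 < k) ∧ (1 ∈ K → IsUnit (1 + b 1 1) ∧ IsUnit (1 + b 1 1 - l))

/-- `p` and `q` have no constant term and are inverse to each other under composition. -/
def AreCompInverse {S : Type*} [CommRing S] (p q : PowerSeries S) : Prop :=
  PowerSeries.constantCoeff p = 0 ∧ PowerSeries.constantCoeff q = 0 ∧
    PowerSeries.subst q p = (PowerSeries.X : PowerSeries S) ∧
    PowerSeries.subst p q = (PowerSeries.X : PowerSeries S)

/-! Both families in (1) solve systems `W_α = Y_α ∏_i (h + ∑_β N(α,i,β) W_β)`: the direct one with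
`h = X` and `N = -M`, the complementary one with `h = -X` and `N = J - M`. The factor `Y_α`
lengthens words by one letter, so the right-hand side is a contraction for the filtration by word
length, and for each `h` and `N` there is exactly one solution among all families
(`existsUnique_sysOp`). Admissibility then comes for free (`admissible_of_sysOp_eq`).

Two remarks give the inversion formula. Since `∘_X g̃` is a ring homomorphism compatible with
locally finite sums, the `g_α ∘ g̃` solve the direct system with `X` replaced by `g̃`
(`comp_sysOp`). Since `g̃ = -X + ∑ g̃_β`, the sum can be moved into the coefficients, where it adds
`J` to `N`; so the `g̃_α` solve that same system (`sysOp_add_formalSum`). By uniqueness `g_α ∘ g̃ =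
g̃_α`, hence `g ∘ g̃ = -g̃ + ∑ g̃_α = X`. The other order is symmetric, with `-g + ∑ g_α = X`.

Part (2) repeats this for one scalar equation with the `X`-adic filtration. Only the summand `k = 1`
fails to contract; its linear part is divided out, which is where the invertibility assumptions
enter.

In (3), `h(uX)` has inverse `g̃` exactly when `h` has inverse `u g̃`. For the presentations, keep
only the parameters `β_{k,1}`: the equation becomes `p = X^m/(1-X) - D p`, with `D` the generating
series of these parameters, and it is solved for `D`. -/

/-! ### Fixed points of contractions -/

/-- A contraction of a complete separated space, the topology being given by equivalence relations
`r 0`, `r 1`, …, has a unique fixed point. -/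
theorem existsUnique_fixedPoint_of_contraction {E : Type*} [Nonempty E] (r : ℕ → E → E → Prop)
    (equiv : ∀ n, Equivalence (r n)) (zero : ∀ x y, r 0 x y)
    (separated : ∀ x y, (∀ n, r n x y) → x = y)
    (complete : ∀ x : ℕ → E, (∀ n, r n (x n) (x (n + 1))) → ∃ y, ∀ n, r n (x n) y)
    (Φ : E → E) (contr : ∀ n x y, r n x y → r (n + 1) (Φ x) (Φ y)) : ∃! x, Φ x = x := by
  obtain ⟨e⟩ := ‹Nonempty E›
  have hstep : ∀ n, r n (Φ^[n] e) (Φ^[n + 1] e) := by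
    intro n
    induction n with
    | zero => exact zero _ _
    | succ n ih =>
      rw [Function.iterate_succ_apply', Function.iterate_succ_apply']
      exact contr _ _ _ ih
  obtain ⟨y, hy⟩ := complete _ hstep
  refine ⟨y, separated _ _ fun n => ?_, fun z hz => separated _ _ fun n => ?_⟩
  · cases n with
    | zero => exact zero _ _
    | succ n =>
      have h := contr _ _ _ (hy n)
      rw [← Function.iterate_succ_apply' Φ] at h
      exact (equiv _).trans ((equiv _).symm h) (hy (n + 1))
  -- A fixed point `z` agrees with `y` at level 0, and applying `Φ` to both raises the level by one.
  · induction n with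
    | zero => exact zero _ _
    | succ n ih =>
      have h := contr _ _ _ ih
      rwa [hz, show Φ y = y from separated _ _ fun m => ?_] at h
      cases m with
      | zero => exact zero _ _
      | succ m =>
        have h := contr _ _ _ (hy m)
        rw [← Function.iterate_succ_apply' Φ] at h
        exact (equiv _).trans ((equiv _).symm h) (hy (m + 1))

namespace NCSeries

variable {R A : Type*} [Ring R]

/-! ### Components -/

lemma ext_coeff {f g : NCSeries R A} (h : ∀ w, coeff w f = coeff w g) : f = g :=
  Subtype.ext (funext h)

@[simp] lemma coeff_add (w : List (Letter A)) (f g : NCSeries R A) :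
    coeff w (f + g) = coeff w f + coeff w g := rfl

@[simp] lemma coeff_neg (w : List (Letter A)) (f : NCSeries R A) :
    coeff w (-f) = -coeff w f := rfl

@[simp] lemma coeff_zero (w : List (Letter A)) : coeff w (0 : NCSeries R A) = 0 := rfl

/-- The component at a word as an additive map. -/
def coeffHom (w : List (Letter A)) : NCSeries R A →+ NCPoly R A where
  toFun := coeff w
  map_zero' := rfl
  map_add' _ _ := rfl

lemma coeff_sum {ι : Type*} (w : List (Letter A)) (s : Finset ι) (f : ι → NCSeries R A) :
    coeff w (∑ i ∈ s, f i) = ∑ i ∈ s, coeff w (f i) :=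
  map_sum (coeffHom w) f s

lemma coeff_mul (w : List (Letter A)) (f g : NCSeries R A) : coeff w (f * g)
    = ∑ i ∈ Finset.range (w.length + 1), coeff (w.take i) f * coeff (w.drop i) g := rfl

lemma coeff_formalSum {ι : Type*} (w : List (Letter A)) (v : ι → NCSeries R A) :
    coeff w (formalSum v) = ∑ᶠ i, coeff w (v i) := rfl

lemma coeff_letter_of_ne {w : List (Letter A)} {z : Letter A} (h : w ≠ [z]) :
    coeff w (letter z : NCSeries R A) = 0 := WordFamily.single_of_ne h

@[simp] lemma coeff_nil_X : coeff [] (X : NCSeries R A) = 0 :=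
  coeff_letter_of_ne (List.cons_ne_nil _ _).symm

lemma coeff_nil_Y_mul (α : A) (f : NCSeries R A) : coeff [] (Y α * f) = 0 := by
  rw [coeff_mul]
  simp [show coeff [] (Y α : NCSeries R A) = 0 from coeff_letter_of_ne (List.cons_ne_nil _ _).symm]

-- Only the splitting after the first letter contributes. This shift by one letter is the source of
-- contraction in the noncommutative systems.
open Classical in
lemma coeff_cons_Y_mul (α : A) (f : NCSeries R A) (z : Letter A) (w : List (Letter A)) :
    coeff (z :: w) (Y α * f) = if z = Letter.Y α then NCPoly.letter z * coeff w f else 0 := by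
  have h0 : (Y α : NCSeries R A).1 [] = 0 := coeff_letter_of_ne (List.cons_ne_nil _ _).symm
  have h1 : (Y α : NCSeries R A).1.tail z
      = WordFamily.const (if z = Letter.Y α then NCPoly.letter z else 0) := by
    funext u
    change (if z :: u = [Letter.Y α] then NCPoly.letter (Letter.Y α) else 0) = _
    cases u with
    | nil => by_cases h : z = Letter.Y α <;> simp [h]
    | cons y u => simp
  change ((Y α : NCSeries R A).1 * f.1) (z :: w) = _
  rw [WordFamily.mul_cons, h0, zero_mul, zero_add, h1, WordFamily.const_mul_apply, ite_mul,
    zero_mul]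
  rfl

lemma exists_of_coeff_Y_mul_ne {α : A} {f : NCSeries R A} {w : List (Letter A)}
    (h : coeff w (Y α * f) ≠ 0) : ∃ u, w = Letter.Y α :: u ∧ coeff u f ≠ 0 := by
  classical
  cases w with
  | nil => exact absurd (coeff_nil_Y_mul α f) h
  | cons z u =>
    rw [coeff_cons_Y_mul] at h
    split_ifs at h with hz
    · exact ⟨u, by rw [hz], right_ne_zero_of_mul h⟩
    · exact absurd rfl h

/-! ### Locally finite families -/

/-- At each word only finitely many members of the family have a non-zero component. -/
def LocallyFinite {ι : Type*} (v : ι → NCSeries R A) : Prop :=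
  ∀ w, {i | coeff w (v i) ≠ 0}.Finite

lemma LocallyFinite.C_mul {ι : Type*} {v : ι → NCSeries R A} (hv : LocallyFinite v) (r : ι → R) :
    LocallyFinite fun i => C (r i) * v i := fun w =>
  (hv w).subset fun i hi => right_ne_zero_of_mul (by rwa [← coeff_C_mul])

lemma formalSum_add {ι : Type*} {v v' : ι → NCSeries R A} (hv : LocallyFinite v)
    (hv' : LocallyFinite v') : formalSum (fun i => v i + v' i) = formalSum v + formalSum v' :=
  ext_coeff fun w => finsum_add_distrib (hv w) (hv' w)

lemma formalSum_neg {ι : Type*} (v : ι → NCSeries R A) :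
    formalSum (fun i => -v i) = -formalSum v :=
  ext_coeff fun w => finsum_neg_distrib fun i => coeff w (v i)

/-! ### Composition is a homomorphism -/

/-- The words which contribute to the component at `w` of a composition. -/
def wordsIn (w : List (Letter A)) : Set (List (Letter A)) :=
  {u | u.length ≤ w.length ∧ ∀ z ∈ u, z ∈ Letter.X :: w}

lemma finite_wordsIn (w : List (Letter A)) : (wordsIn w).Finite := by
  have := (List.finite_toSet (Letter.X :: w)).to_subtype
  refine ((List.finite_length_le {z | z ∈ Letter.X :: w} w.length).image
    (List.map Subtype.val)).subset ?_
  rintro u ⟨hu, hz⟩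
  exact ⟨u.attach.map fun z => ⟨z.1, hz z.1 z.2⟩, by simpa using hu, by simp⟩

lemma wordsIn_mono {u w : List (Letter A)} (h : u.Sublist w) : wordsIn u ⊆ wordsIn w :=
  fun _ hv => ⟨hv.1.trans h.length_le, fun z hz =>
    List.mem_cons.mpr ((List.mem_cons.mp (hv.2 z hz)).imp_right fun e => h.subset e)⟩

/-- Each letter of `u` becomes a non-empty piece of the resulting word, and every `Y` survives.
Hence one finite set of words suffices to compute a component of any composition. -/
lemma coeff_substHom_eq_zero {h : NCSeries R A} (h0 : coeff [] h = 0) {u w : List (Letter A)}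
    {a : NCPoly R A} (ha : a ∈ NCPoly.wordPart u) (hu : u ∉ wordsIn w) :
    coeff w (substHom h a) = 0 := by
  induction ha using AddSubgroup.closure_induction with
  | mem m hm =>
    by_contra hne
    obtain ⟨h1, h2⟩ := substHom_monomial_coeff h0 hm hne
    exact hu ⟨h1, fun z hz => List.mem_cons.mpr (h2 z hz)⟩
  | zero => rw [map_zero, coeff_zero]
  | add x y _ _ hx hy => rw [map_add, coeff_add, hx, hy, add_zero]
  | neg x _ hx => rw [map_neg, coeff_neg, hx, neg_zero]

lemma coeff_comp (f : NCSeries R A) {h : NCSeries R A} (h0 : coeff [] h = 0)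
    {w : List (Letter A)} {T : Finset (List (Letter A))} (hT : wordsIn w ⊆ T) :
    coeff w (comp f h) = ∑ u ∈ T, coeff w (substHom h (coeff u f)) := by
  refine finsum_eq_sum_of_support_subset _ fun u hu => hT ?_
  by_contra hcon
  exact hu (coeff_substHom_eq_zero h0 (f.2 u) hcon)

lemma comp_add (f g : NCSeries R A) {h : NCSeries R A} (h0 : coeff [] h = 0) :
    comp (f + g) h = comp f h + comp g h := by
  refine ext_coeff fun w => ?_
  have hT : wordsIn w ⊆ (finite_wordsIn w).toFinset := by simp
  rw [coeff_add, coeff_comp _ h0 hT, coeff_comp _ h0 hT, coeff_comp _ h0 hT,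
    ← Finset.sum_add_distrib]
  simp only [coeff_add, map_add]

lemma comp_mul (f g : NCSeries R A) {h : NCSeries R A} (h0 : coeff [] h = 0) :
    comp (f * g) h = comp f h * comp g h := by
  classical
  refine ext_coeff fun w => ?_
  set T := (finite_wordsIn w).toFinset with hTdef
  have hmem : ∀ u, u ∈ T ↔ u ∈ wordsIn w := fun u => by simp [hTdef]
  have hT : wordsIn w ⊆ T := fun u hu => by simpa [hTdef] using hu
  -- Prefixes and suffixes of `w` need no words outside `T`, so a single index set serves all
  -- splittings of `w`.
  have hR : coeff w (comp f h * comp g h) = ∑ p ∈ T ×ˢ T,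
      coeff w (substHom h (coeff p.1 f * coeff p.2 g)) := by
    simp only [map_mul, coeff_mul]
    rw [Finset.sum_comm]
    refine Finset.sum_congr rfl fun i _ => ?_
    rw [coeff_comp f h0 ((wordsIn_mono (List.take_sublist i w)).trans hT),
      coeff_comp g h0 ((wordsIn_mono (List.drop_sublist i w)).trans hT), Finset.sum_mul_sum,
      Finset.sum_product]
  have hvanish : ∀ p ∈ T ×ˢ T, coeff w (substHom h (coeff p.1 f * coeff p.2 g)) ≠ 0 →
      p.1 ++ p.2 ∈ T := by
    intro p _ hp
    by_contra hcon
    exact hp (coeff_substHom_eq_zero h0 (NCPoly.wordPart_mul (f.2 p.1) (g.2 p.2))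
      (fun e => hcon ((hmem _).mpr e)))
  rw [hR, ← Finset.sum_filter_of_ne hvanish, coeff_comp _ h0 hT]
  simp only [coeff_mul (f := f) (g := g), map_sum, coeff_sum]
  rw [Finset.sum_sigma']
  -- A word of `T` with a cutting position is the same as a pair of words whose concatenation lies
  -- in `T`.
  refine Finset.sum_bij (fun x _ => (x.1.take x.2, x.1.drop x.2)) ?_ ?_ ?_ ?_
  · rintro ⟨u, i⟩ hx
    rw [Finset.mem_sigma] at hx
    have hu := (hmem _).mp hx.1
    rw [Finset.mem_filter, Finset.mem_product, hmem, hmem]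
    refine ⟨⟨⟨(List.take_sublist i u).length_le.trans hu.1,
      fun z hz => hu.2 z ((List.take_sublist i u).subset hz)⟩,
      ⟨(List.drop_sublist i u).length_le.trans hu.1,
      fun z hz => hu.2 z ((List.drop_sublist i u).subset hz)⟩⟩, ?_⟩
    simpa using hx.1
  · rintro ⟨u, i⟩ hx ⟨v, j⟩ hy hxy
    simp only [Finset.mem_sigma, Finset.mem_range, Prod.mk.injEq] at hx hy hxy
    obtain rfl : u = v := by
      rw [← List.take_append_drop i u, hxy.1, hxy.2, List.take_append_drop]
    have := congrArg List.length hxy.1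
    simp only [List.length_take] at this
    obtain rfl : i = j := by omega
    rfl
  · rintro ⟨a, b⟩ hp
    rw [Finset.mem_filter] at hp
    refine ⟨⟨a ++ b, a.length⟩, ?_, by simp⟩
    rw [Finset.mem_sigma, Finset.mem_range]
    exact ⟨hp.2, by simp only [List.length_append]; omega⟩
  · rintro ⟨u, i⟩ _
    rfl

lemma comp_eq_substHom_of_concentrated {f h : NCSeries R A} {u : List (Letter A)}
    (hf : ∀ v, v ≠ u → coeff v f = 0) : comp f h = substHom h (coeff u f) :=
  ext_coeff fun w => finsum_eq_single _ u fun v hv => by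
    simp only [hf v hv, map_zero, coeff_zero]

lemma comp_C (r : R) (h : NCSeries R A) : comp (C r) h = C r := by
  rw [comp_eq_substHom_of_concentrated (u := [])]
  · exact NCPoly.lift_C _ _ _
  · intro v hv
    cases v with
    | nil => exact absurd rfl hv
    | cons z v => rfl

lemma comp_letter (z : Letter A) (h : NCSeries R A) :
    comp (letter z) h = substHom h (NCPoly.letter z) := by
  rw [comp_eq_substHom_of_concentrated fun v => coeff_letter_of_ne]
  exact congrArg _ (WordFamily.single_self z _)

lemma comp_X (h : NCSeries R A) : comp X h = h :=
  (comp_letter _ h).trans (substHom_letter h _)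

lemma comp_Y (α : A) (h : NCSeries R A) : comp (Y α) h = Y α :=
  (comp_letter _ h).trans (substHom_letter h _)

/-- Composition with a series without constant term as a ring homomorphism. -/
noncomputable def compHom {h : NCSeries R A} (h0 : coeff [] h = 0) :
    NCSeries R A →+* NCSeries R A :=
  RingHom.mk' ⟨⟨fun f => comp f h, by rw [← map_one C, comp_C]⟩, fun f g => comp_mul f g h0⟩
    fun f g => comp_add f g h0

lemma compHom_apply {h : NCSeries R A} (h0 : coeff [] h = 0) (f : NCSeries R A) :
    compHom h0 f = comp f h := rfl

lemma comp_formalSum {ι : Type*} {v : ι → NCSeries R A} (hv : LocallyFinite v)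
    {h : NCSeries R A} (h0 : coeff [] h = 0) :
    comp (formalSum v) h = formalSum fun i => comp (v i) h := by
  classical
  refine ext_coeff fun w => ?_
  have hT : wordsIn w ⊆ (finite_wordsIn w).toFinset := by simp
  set T := (finite_wordsIn w).toFinset
  let I : Finset ι := T.biUnion fun u => (hv u).toFinset
  have hI : ∀ u ∈ T, ∀ i, coeff u (v i) ≠ 0 → i ∈ I := fun u hu i hi =>
    Finset.mem_biUnion.mpr ⟨u, hu, by simpa using hi⟩
  rw [coeff_comp _ h0 hT, coeff_formalSum, finsum_eq_sum_of_support_subset (s := I)]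
  · simp only [coeff_comp _ h0 hT]
    rw [Finset.sum_comm]
    refine Finset.sum_congr rfl fun u hu => ?_
    rw [coeff_formalSum, finsum_eq_sum_of_support_subset (s := I) _ fun i hi => hI u hu i hi,
      map_sum, coeff_sum]
  · intro i hi
    rw [Function.mem_support, coeff_comp _ h0 hT] at hi
    obtain ⟨u, hu, hne⟩ := Finset.exists_ne_zero_of_sum_ne_zero hi
    refine hI u hu i fun h => hne ?_
    rw [h, map_zero, coeff_zero]

/-! ### Systems of equations -/

/-- The operator whose fixed points are the solutions of
`W_α = Y_α (h + ∑_β N(α, 1, β) W_β) ⋯ (h + ∑_β N(α, d_α, β) W_β)`. -/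
noncomputable def sysOp {d : A → ℕ} (h : NCSeries R A) (N : (α : A) → Fin (d α) → A → R)
    (W : A → NCSeries R A) (α : A) : NCSeries R A :=
  Y α * (List.ofFn fun i => h + formalSum fun β => C (N α i β) * W β).prod

/-- The components of the two series at all words of length less than `n` agree. -/
def AgreeBelow (n : ℕ) (f g : NCSeries R A) : Prop :=
  ∀ w : List (Letter A), w.length < n → coeff w f = coeff w g

lemma AgreeBelow.mul {n : ℕ} {f f' g g' : NCSeries R A} (hf : AgreeBelow n f f')
    (hg : AgreeBelow n g g') : AgreeBelow n (f * g) (f' * g') := by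
  intro w hw
  rw [coeff_mul, coeff_mul]
  refine Finset.sum_congr rfl fun i _ => ?_
  rw [hf _ ((List.take_sublist i w).length_le.trans_lt hw),
    hg _ ((List.drop_sublist i w).length_le.trans_lt hw)]

lemma AgreeBelow.ofFn_prod {n k : ℕ} {f g : Fin k → NCSeries R A}
    (h : ∀ i, AgreeBelow n (f i) (g i)) : AgreeBelow n (List.ofFn f).prod (List.ofFn g).prod := by
  induction k with
  | zero => simp [AgreeBelow]
  | succ k ih =>
    rw [List.ofFn_succ, List.ofFn_succ, List.prod_cons, List.prod_cons]
    exact (h 0).mul (ih fun i => h i.succ)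

lemma AgreeBelow.Y_mul {n : ℕ} {f g : NCSeries R A} (h : AgreeBelow n f g) (α : A) :
    AgreeBelow (n + 1) (Y α * f) (Y α * g) := by
  classical
  intro w hw
  cases w with
  | nil => rw [coeff_nil_Y_mul, coeff_nil_Y_mul]
  | cons z w =>
    rw [coeff_cons_Y_mul, coeff_cons_Y_mul, h w (by simpa using hw)]

theorem existsUnique_sysOp {d : A → ℕ} (h : NCSeries R A) (N : (α : A) → Fin (d α) → A → R) :
    ∃! W, sysOp h N W = W := by
  refine existsUnique_fixedPoint_of_contraction
    (fun n V W => ∀ α, AgreeBelow n (V α) (W α)) (fun n => ⟨fun _ _ _ _ => rfl,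
      fun H α w hw => (H α w hw).symm,
      fun H H' α w hw => by rw [H α w hw, H' α w hw]⟩)
    (fun _ _ _ w hw => absurd hw (by simp))
    (fun V W H => funext fun α => ext_coeff fun w => H (w.length + 1) α w (Nat.lt_succ_self _))
    (fun x hx => ?_) _ (fun n V W H α => AgreeBelow.Y_mul (AgreeBelow.ofFn_prod fun i => ?_) α)
  -- The component at `w` is constant along the sequence from index `w.length + 1` on, so it is read
  -- off there.
  · refine ⟨fun α => ⟨fun w => coeff w (x (w.length + 1) α),
      fun w => (x (w.length + 1) α).2 w⟩, fun n α w hw => ?_⟩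
    change coeff w (x n α) = coeff w (x (w.length + 1) α)
    induction n, hw using Nat.le_induction with
    | base => rfl
    | succ n hn ih => rw [← hx n α w hn, ih]
  · intro w hw
    rw [coeff_add, coeff_add, coeff_formalSum, coeff_formalSum]
    congr 1
    refine finsum_congr fun β => ?_
    rw [coeff_C_mul, coeff_C_mul, H β w hw]

lemma exists_of_coeff_sysOp_ne {d : A → ℕ} {h : NCSeries R A}
    {N : (α : A) → Fin (d α) → A → R} {W : A → NCSeries R A} (hW : sysOp h N W = W) {α : A}
    {w : List (Letter A)} (hw : coeff w (W α) ≠ 0) : ∃ u, w = Letter.Y α :: u ∧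
      coeff u (List.ofFn fun i => h + formalSum fun β => C (N α i β) * W β).prod ≠ 0 := by
  rw [← hW] at hw
  exact exists_of_coeff_Y_mul_ne hw

lemma exists_ofFn_prod_eq_mul {T : Type*} [Monoid T] {k : ℕ} (hk : 0 < k) (f : Fin k → T) :
    ∃ g, (List.ofFn f).prod = f ⟨0, hk⟩ * g := by
  obtain ⟨k, rfl⟩ := Nat.exists_eq_succ_of_ne_zero hk.ne'
  exact ⟨_, by rw [List.ofFn_succ, List.prod_cons]; rfl⟩

/-- Every word of `W α` starts with `Y α`; this supplies a `Y` and leaves at most one member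
non-zero at each word. The letter `X` is found in the first factor of the product, which exists
because `0 < d α`. -/
theorem admissible_of_sysOp_eq {d : A → ℕ} (hd : ∀ α, 0 < d α) {h : NCSeries R A}
    (hX : ∀ w, coeff w h ≠ 0 → Letter.X ∈ w) {N : (α : A) → Fin (d α) → A → R}
    {W : A → NCSeries R A} (hW : sysOp h N W = W) : Admissible W where
  support α w hw := by
    refine ⟨?_, α, ?_⟩
    · induction hn : w.length using Nat.strong_induction_on generalizing w α with
      | _ n ih =>
        obtain ⟨u, rfl, hu⟩ := exists_of_coeff_sysOp_ne hW hw
        obtain ⟨g, hg⟩ := exists_ofFn_prod_eq_mul (hd α)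
          fun i => h + formalSum fun β => C (N α i β) * W β
        rw [hg] at hu
        obtain ⟨u₁, u₂, rfl, h₁, -⟩ := exists_of_coeff_mul_ne hu
        -- The piece `u₁` comes either from `h` or from some `W β`; in the latter case it is shorter
        -- than the original word and induction applies.
        have key : Letter.X ∈ u₁ := by
          by_cases h0 : coeff u₁ h = 0
          · rw [coeff_add, h0, zero_add, coeff_formalSum] at h₁
            obtain ⟨β, hβ⟩ : ∃ β, coeff u₁ (C (N α ⟨0, hd α⟩ β) * W β) ≠ 0 := by
              by_contra! H
              exact h₁ (finsum_eq_zero_of_forall_eq_zero H)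
            rw [coeff_C_mul] at hβ
            exact ih u₁.length (by simp only [← hn, List.length_cons, List.length_append]; omega)
              β u₁ (right_ne_zero_of_mul hβ) rfl
          · exact hX _ h0
        exact List.mem_cons_of_mem _ (List.mem_append_left _ key)
    · obtain ⟨u, rfl, -⟩ := exists_of_coeff_sysOp_ne hW hw
      exact List.mem_cons_self
  locallyFinite w := by
    refine Set.Subsingleton.finite fun α hα β hβ => ?_
    obtain ⟨u, rfl, -⟩ := exists_of_coeff_sysOp_ne hW hα
    obtain ⟨v, hv, -⟩ := exists_of_coeff_sysOp_ne hW hβ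
    exact Letter.Y.inj (List.cons.inj hv).1

/-! ### Substitution into systems and the inversion formula -/

lemma comp_sysOp {d : A → ℕ} {f h : NCSeries R A} (h0 : coeff [] h = 0)
    {N : (α : A) → Fin (d α) → A → R} {V : A → NCSeries R A} (hfin : LocallyFinite V)
    (hV : sysOp f N V = V) :
    sysOp (comp f h) N (fun α => comp (V α) h) = fun α => comp (V α) h := by
  funext α
  conv_rhs => rw [← hV]
  rw [sysOp, sysOp, comp_mul _ _ h0, comp_Y, ← compHom_apply h0 (List.prod _), map_list_prod,
    List.map_ofFn]
  congr 3
  funext i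
  rw [Function.comp_apply, compHom_apply, comp_add _ _ h0,
    comp_formalSum (hfin.C_mul _) h0]
  congr 2
  funext β
  rw [comp_mul _ _ h0, comp_C]

/-- Absorbing `∑ V_β` into the linear forms adds 1 to every coefficient: this is why the
complementary matrices `J - M` appear. -/
lemma sysOp_add_formalSum {d : A → ℕ} (f : NCSeries R A) (N : (α : A) → Fin (d α) → A → R)
    {V : A → NCSeries R A} (hfin : LocallyFinite V) :
    sysOp (f + formalSum V) N V = sysOp f (fun α i β => 1 + N α i β) V := by
  funext α
  rw [sysOp, sysOp]
  congr 3
  funext i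
  rw [add_assoc, ← formalSum_add hfin (hfin.C_mul _)]
  congr 2
  funext β
  rw [map_add, map_one, add_mul, one_mul]

lemma Admissible.coeff_nil_total {V : A → NCSeries R A} (hV : Admissible V) :
    coeff [] (total V) = 0 := by
  have h : ∀ α, coeff [] (V α) = 0 := fun α => by
    by_contra hne
    exact List.not_mem_nil (hV.support α [] hne).1
  rw [total, coeff_add, coeff_neg, coeff_nil_X, coeff_formalSum, finsum_congr h, finsum_zero,
    neg_zero, add_zero]

lemma total_comp {V W : A → NCSeries R A} (hV : Admissible V) {h : NCSeries R A}
    (h0 : coeff [] h = 0) (hW : (fun α => comp (V α) h) = W) :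
    comp (total V) h = -h + formalSum W := by
  rw [total, comp_add _ _ h0, ← compHom_apply h0 (-X), map_neg, compHom_apply, comp_X,
    comp_formalSum hV.locallyFinite h0, hW]

theorem comp_total_eq_X {d : A → ℕ} {N : (α : A) → Fin (d α) → A → R}
    {V W : A → NCSeries R A} (hV : Admissible V) (hW : Admissible W)
    (hVN : sysOp X N V = V) (hWN : sysOp (-X) (fun α i β => 1 + N α i β) W = W) :
    comp (total V) (total W) = X ∧ comp (total W) (total V) = X := by
  have hV0 := hV.coeff_nil_total
  have hW0 := hW.coeff_nil_total
  constructor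
  -- Both `V_α ∘ total W` and `W_α` solve the system with inhomogeneous term `total W` and
  -- coefficients `N`.
  · rw [total_comp hV hW0 ((existsUnique_sysOp (total W) N).unique ?_ ?_), total]
    · abel
    · have := comp_sysOp hW0 hV.locallyFinite hVN
      rwa [comp_X] at this
    · rw [total, sysOp_add_formalSum _ _ hW.locallyFinite, hWN]
  · rw [total_comp hW hV0 ((existsUnique_sysOp (-total V)
      fun α i β => 1 + N α i β).unique ?_ ?_), total]
    · abel
    · have := comp_sysOp hV0 hW.locallyFinite hWN
      rwa [← compHom_apply hV0 (-X), map_neg, compHom_apply, comp_X] at this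
    · rw [← sysOp_add_formalSum _ _ hV.locallyFinite, total,
        show -(-X + formalSum V) + formalSum V = X by abel, hVN]

/-! ### The defining equations as fixed-point equations -/

/-- The map `κ` records the part containing a letter, so the equations of all parts form one system.
Admissibility can be dropped on the right because solutions have it automatically. -/
lemma isDirectSystem_iff {K : Set ℕ} {part : K → Set A} {κ : A → K}
    (hκ : ∀ α, α ∈ part (κ α)) (hκ' : ∀ k, ∀ α ∈ part k, κ α = k)
    (M : (k : K) → Fin k → Matrix (part k) A R) (hK : ∀ k ∈ K, 0 < k) (V : A → NCSeries R A) :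
    IsDirectSystem M V ↔ sysOp (d := fun α => κ α) X
      (fun α i β => -M (κ α) i ⟨α, hκ α⟩ β) V = V := by
  have e : ∀ α : A, sysOp (d := fun α => κ α) X (fun α i β => -M (κ α) i ⟨α, hκ α⟩ β) V α
      = Y α * (List.ofFn fun i : Fin (κ α) => X - mulVec (M (κ α) i) V ⟨α, hκ α⟩).prod := by
    intro α
    rw [sysOp]
    congr 3
    funext i
    rw [sub_eq_add_neg, mulVec, ← formalSum_neg]
    simp only [map_neg, neg_mul]
  constructor
  · intro h
    funext α
    rw [e]
    exact (h.eqn (κ α) ⟨α, hκ α⟩).symm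
  · intro h
    refine ⟨admissible_of_sysOp_eq (fun α => hK _ (κ α).2) (fun w hw => ?_) h, ?_⟩
    · by_contra hX
      refine hw (coeff_letter_of_ne ?_)
      rintro rfl
      simp at hX
    · rintro k ⟨α, hα⟩
      obtain rfl := hκ' k α hα
      rw [← e, h]

lemma isComplementarySystem_iff {K : Set ℕ} {part : K → Set A} {κ : A → K}
    (hκ : ∀ α, α ∈ part (κ α)) (hκ' : ∀ k, ∀ α ∈ part k, κ α = k)
    (M : (k : K) → Fin k → Matrix (part k) A R) (hK : ∀ k ∈ K, 0 < k) (V : A → NCSeries R A) :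
    IsComplementarySystem M V ↔ sysOp (d := fun α => κ α) (-X)
      (fun α i β => 1 + -M (κ α) i ⟨α, hκ α⟩ β) V = V := by
  have e : ∀ α : A,
      sysOp (d := fun α => κ α) (-X) (fun α i β => 1 + -M (κ α) i ⟨α, hκ α⟩ β) V α
      = Y α * (List.ofFn fun i : Fin (κ α) =>
        -X + mulVec ((Matrix.of fun _ _ => 1) - M (κ α) i) V ⟨α, hκ α⟩).prod := by
    intro α
    simp only [sysOp, mulVec, Matrix.sub_apply, Matrix.of_apply, sub_eq_add_neg]
  constructor
  · intro h
    funext α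
    rw [e]
    exact (h.eqn (κ α) ⟨α, hκ α⟩).symm
  · intro h
    refine ⟨admissible_of_sysOp_eq (fun α => hK _ (κ α).2) (fun w hw => ?_) h, ?_⟩
    · by_contra hX
      refine hw (neg_eq_zero.mpr (coeff_letter_of_ne ?_))
      rintro rfl
      simp at hX
    · rintro k ⟨α, hα⟩
      obtain rfl := hκ' k α hα
      rw [← e, h]

theorem directSystem_comp_complementarySystem {K : Set ℕ} (hK : ∀ k ∈ K, 0 < k)
    {part : K → Set A} (hdisj : Pairwise fun k k' => Disjoint (part k) (part k'))
    (hcover : ⋃ k, part k = Set.univ) (M : (k : K) → Fin k → Matrix (part k) A R) :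
    (∃! V : A → NCSeries R A, IsDirectSystem M V) ∧
    (∃! V' : A → NCSeries R A, IsComplementarySystem M V') ∧
    ∀ V V' : A → NCSeries R A, IsDirectSystem M V → IsComplementarySystem M V' →
      comp (total V) (total V') = X ∧ comp (total V') (total V) = X := by
  have hex : ∀ α, ∃ k, α ∈ part k := fun α => Set.mem_iUnion.mp (hcover ▸ Set.mem_univ α)
  choose κ hκ using hex
  have hκ' : ∀ k, ∀ α ∈ part k, κ α = k := fun k α hα => by
    by_contra hne
    exact Set.disjoint_left.mp (hdisj hne) (hκ α) hα
  have h1 := isDirectSystem_iff hκ hκ' M hK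
  have h2 := isComplementarySystem_iff hκ hκ' M hK
  refine ⟨?_, ?_, fun V V' hV hV' => ?_⟩
  · simp only [h1]
    exact existsUnique_sysOp _ _
  · simp only [h2]
    exact existsUnique_sysOp _ _
  · exact comp_total_eq_X hV.toAdmissible hV'.toAdmissible ((h1 V).mp hV) ((h2 V').mp hV')

end NCSeries

namespace PowerSeries

variable {S : Type*} [CommRing S]

/-! ### Formal sums of power series -/

open Classical in
/-- The sum of the members of a family of power series with index in `K` and at most `n`. -/
noncomputable def partialSum (K : Set ℕ) (F : ℕ → PowerSeries S) (n : ℕ) : PowerSeries S :=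
  ∑ k ∈ Finset.range (n + 1) with k ∈ K, F k

/-- The formal sum of the members of a family of power series with index in `K`. -/
noncomputable def familySum (K : Set ℕ) (F : ℕ → PowerSeries S) : PowerSeries S :=
  mk fun n => ∑ᶠ k ∈ K, coeff n (F k)

lemma coeff_partialSum {K : Set ℕ} {F : ℕ → PowerSeries S} (hF : ∀ k, X ^ k ∣ F k) {m n : ℕ}
    (hmn : m ≤ n) : coeff m (partialSum K F n) = ∑ᶠ k ∈ K, coeff m (F k) := by
  classical
  rw [partialSum, map_sum, finsum_mem_eq_sum_of_subset]
  · rintro k ⟨hk, hne⟩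
    have : k ≤ m := by
      by_contra! hlt
      exact hne (X_pow_dvd_iff.mp (hF k) m hlt)
    simp only [Finset.coe_filter, Finset.mem_range, Set.mem_ofPred_eq]
    exact ⟨by omega, hk⟩
  · intro k hk
    simp only [Finset.coe_filter, Set.mem_ofPred_eq] at hk
    exact hk.2

lemma isFormalSum_iff {K : Set ℕ} {F : ℕ → PowerSeries S} (hF : ∀ k, X ^ k ∣ F k)
    (p : PowerSeries S) : IsFormalSum K F p ↔ familySum K F = p := by
  refine ⟨fun h => ext fun n => ?_, ?_⟩
  · rw [familySum, coeff_mk, (h n).2]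
  · rintro rfl n
    refine ⟨(Set.finite_Iic n).subset fun k hk => ?_, coeff_mk _ _⟩
    by_contra hlt
    exact hk.2 (X_pow_dvd_iff.mp (hF k) n (not_le.mp hlt))

/-- Terms with `k > n` vanish modulo `X ^ (n + 1)`, so questions about the infinite sum reduce to
finite sums. -/
lemma X_pow_dvd_familySum_sub {K : Set ℕ} {F : ℕ → PowerSeries S} (hF : ∀ k, X ^ k ∣ F k)
    (n : ℕ) : X ^ (n + 1) ∣ familySum K F - partialSum K F n := by
  rw [X_pow_dvd_iff]
  intro m hm
  rw [map_sub, coeff_partialSum hF (Nat.lt_succ_iff.mp hm), familySum, coeff_mk, sub_self]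

lemma eq_of_forall_X_pow_dvd_sub {p q : PowerSeries S} (h : ∀ n, X ^ (n + 1) ∣ p - q) : p = q := by
  ext n
  have := X_pow_dvd_iff.mp (h n) n (Nat.lt_succ_self n)
  rwa [map_sub, sub_eq_zero] at this

lemma familySum_eq_of_X_pow_dvd {K : Set ℕ} {F : ℕ → PowerSeries S} (hF : ∀ k, X ^ k ∣ F k)
    {p : PowerSeries S} (h : ∀ n, X ^ (n + 1) ∣ p - partialSum K F n) : familySum K F = p :=
  eq_of_forall_X_pow_dvd_sub fun n => by
    simpa using dvd_sub (X_pow_dvd_familySum_sub (K := K) hF n) (h n)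

/-! ### The equation `W = ∑_{k ∈ K} ∏_{j=1}^k (h + c_{k,j} W)` -/

/-- The product `∏_{j=1}^k (h + c_{k,j} W)`. -/
noncomputable def sysTerm (h : PowerSeries S) (c : ℕ → ℕ → S) (W : PowerSeries S) (k : ℕ) :
    PowerSeries S :=
  ∏ j ∈ Finset.Icc 1 k, (h + C (c k j) * W)

lemma X_dvd_add_C_mul {h W : PowerSeries S} (hh : constantCoeff h = 0)
    (hW : constantCoeff W = 0) (r : S) : X ∣ h + C r * W := by
  rw [X_dvd_iff, map_add, map_mul, hh, hW, mul_zero, add_zero]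

lemma X_pow_dvd_sysTerm {h W : PowerSeries S} (hh : constantCoeff h = 0)
    (hW : constantCoeff W = 0) (c : ℕ → ℕ → S) (k : ℕ) : X ^ k ∣ sysTerm h c W k := by
  have := Finset.prod_dvd_prod_of_dvd (s := Finset.Icc 1 k) (fun _ => (X : PowerSeries S))
    (fun j => h + C (c k j) * W) fun j _ => X_dvd_add_C_mul hh hW (c k j)
  simpa [sysTerm] using this

/-- Telescoping: each summand has one difference, divisible by `X ^ (n + 1)`, and `s.card - 1` other
factors divisible by `X`. -/
lemma X_pow_dvd_prod_sub_prod {ι : Type*} {n : ℕ} {a b : ι → PowerSeries S} (s : Finset ι)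
    (ha : ∀ i, X ∣ a i) (hb : ∀ i, X ∣ b i) (hab : ∀ i, X ^ (n + 1) ∣ a i - b i) :
    X ^ (n + s.card) ∣ ∏ i ∈ s, a i - ∏ i ∈ s, b i := by
  classical
  induction s using Finset.induction_on with
  | empty => simp
  | insert i s hi ih =>
    rw [Finset.prod_insert hi, Finset.prod_insert hi, Finset.card_insert_of_notMem hi,
      show a i * ∏ i ∈ s, a i - b i * ∏ i ∈ s, b i
        = (a i - b i) * ∏ i ∈ s, a i + b i * (∏ i ∈ s, a i - ∏ i ∈ s, b i) by ring]
    refine dvd_add ?_ ?_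
    · have h1 : X ^ s.card ∣ ∏ i ∈ s, a i := by
        simpa using Finset.prod_dvd_prod_of_dvd (s := s) (fun _ => (X : PowerSeries S)) a
          fun i _ => ha i
      rw [show n + (s.card + 1) = (n + 1) + s.card by ring, pow_add]
      exact mul_dvd_mul (hab i) h1
    · rw [← add_assoc, pow_succ']
      exact mul_dvd_mul (hb i) ih

/-- `W` has no constant term and solves the equation. -/
def IsSysSol (K : Set ℕ) (h : PowerSeries S) (c : ℕ → ℕ → S) (W : PowerSeries S) : Prop :=
  constantCoeff W = 0 ∧ familySum K (sysTerm h c W) = W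

-- The terms with `k ≥ 2` gain a power of `X`, by the telescoping estimate. The term `k = 1` is
-- affine in the unknown, and the subtracted multiple of `V - W` cancels it exactly.
open Classical in
lemma X_pow_dvd_partialSum_sub {K : Set ℕ} {h V W : PowerSeries S}
    (hh : constantCoeff h = 0) (hV : constantCoeff V = 0) (hW : constantCoeff W = 0)
    (c : ℕ → ℕ → S) {n : ℕ} (hVW : X ^ (n + 1) ∣ V - W) :
    X ^ (n + 2) ∣ partialSum K (sysTerm h c V) (n + 1) - partialSum K (sysTerm h c W) (n + 1)
      - C (if 1 ∈ K then c 1 1 else 0) * (V - W) := by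
  have hlin : C (if 1 ∈ K then c 1 1 else 0) * (V - W)
      = ∑ k ∈ Finset.range (n + 2) with k ∈ K,
        if k = 1 then C (c 1 1) * (V - W) else 0 := by
    rw [Finset.sum_ite_eq']
    by_cases h1 : 1 ∈ K <;> simp [h1]
  rw [hlin, partialSum, partialSum, ← Finset.sum_sub_distrib, ← Finset.sum_sub_distrib]
  refine Finset.dvd_sum fun k _ => ?_
  rcases k with _ | _ | k
  · simp [sysTerm]
  · simp only [sysTerm, zero_add, Finset.Icc_self, Finset.prod_singleton, if_true]
    ring_nf
    exact dvd_zero _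
  · rw [if_neg (by omega), sub_zero]
    have := X_pow_dvd_prod_sub_prod (n := n) (Finset.Icc 1 (k + 1 + 1))
      (fun j => X_dvd_add_C_mul hh hV (c (k + 1 + 1) j))
      (fun j => X_dvd_add_C_mul hh hW (c (k + 1 + 1) j)) fun j => by
        rw [add_sub_add_left_eq_sub, ← mul_sub]
        exact hVW.mul_left _
    refine (pow_dvd_pow _ ?_).trans this
    simp

/-- With `G` the right-hand side and `a` its linear coefficient in `W`, the equation `G W = W` is
rewritten as `W = (1 - a)⁻¹ (G W - a W)`, whose right-hand side is an `X`-adic contraction. -/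
theorem existsUnique_isSysSol {K : Set ℕ} (hK : ∀ k ∈ K, 0 < k) {h : PowerSeries S}
    (hh : constantCoeff h = 0) {c : ℕ → ℕ → S} (hc : 1 ∈ K → IsUnit (1 - c 1 1)) :
    ∃! W, IsSysSol K h c W := by
  classical
  obtain ⟨a, ha, u, hu⟩ : ∃ a, a = (if 1 ∈ K then c 1 1 else 0) ∧ ∃ u : S, u * (1 - a) = 1 := by
    refine ⟨_, rfl, ?_⟩
    by_cases h1 : 1 ∈ K
    · rw [if_pos h1]
      exact (hc h1).exists_left_inv
    · exact ⟨1, by simp [h1]⟩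
  have hu' : C u * (1 - C a) = (1 : PowerSeries S) := by
    rw [← map_one C, ← map_sub, ← map_mul, hu]
  have hG0 : ∀ W : PowerSeries S, constantCoeff W = 0 →
      constantCoeff (familySum K (sysTerm h c W)) = 0 := by
    intro W hW
    have h1 := X_pow_dvd_familySum_sub (K := K) (X_pow_dvd_sysTerm hh hW c) 0
    have h2 : partialSum K (sysTerm h c W) 0 = 0 := by
      refine Finset.sum_eq_zero fun k hk => ?_
      simp only [Finset.mem_filter, Finset.mem_range] at hk
      have := hK k hk.2
      omega
    rwa [h2, sub_zero, zero_add, pow_one, X_dvd_iff] at h1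
  let E := {W : PowerSeries S // constantCoeff W = 0}
  let Φ : E → E := fun W => ⟨C u * (familySum K (sysTerm h c W.1) - C a * W.1), by
    rw [map_mul, map_sub, map_mul, W.2, hG0 _ W.2, mul_zero, sub_zero, mul_zero]⟩
  have hΦ : ∀ W : E, Φ W = W ↔ IsSysSol K h c W.1 := by
    intro W
    rw [Subtype.ext_iff, IsSysSol, and_iff_right W.2]
    change C u * (familySum K (sysTerm h c W.1) - C a * W.1) = W.1 ↔ _
    constructor
    · intro H
      linear_combination (1 - C a) * H - (familySum K (sysTerm h c W.1) - C a * W.1) * hu'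
    · intro H
      rw [H]
      linear_combination W.1 * hu'
  have : Nonempty E := ⟨⟨0, map_zero _⟩⟩
  suffices hfix : ∃! W, Φ W = W by
    obtain ⟨W, hW, huniq⟩ := hfix
    exact ⟨W.1, (hΦ W).mp hW, fun V hV =>
      congrArg Subtype.val (huniq ⟨V, hV.1⟩ ((hΦ ⟨V, hV.1⟩).mpr hV))⟩
  -- Level `n` is congruence modulo `X ^ (n + 1)`; level 0 is vacuous because constant terms vanish.
  refine existsUnique_fixedPoint_of_contraction
    (fun n (V W : E) => X ^ (n + 1) ∣ V.1 - W.1)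
    (fun n => ⟨fun V => by simp, fun H => by rw [dvd_sub_comm]; exact H,
      fun H H' => by simpa using dvd_add H H'⟩)
    (fun V W => by rw [zero_add, pow_one, X_dvd_iff, map_sub, V.2, W.2, sub_zero])
    (fun V W H => Subtype.ext (eq_of_forall_X_pow_dvd_sub H))
    (fun x hx => ?_) Φ (fun n V W H => ?_)
  · have key : ∀ m n, m ≤ n → coeff m (x n).1 = coeff m (x m).1 := by
      intro m n hmn
      induction n, hmn using Nat.le_induction with
      | base => rfl
      | succ n hn ih =>
        have := X_pow_dvd_iff.mp (hx n) m (Nat.lt_succ_of_le hn)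
        rw [map_sub, sub_eq_zero] at this
        rw [← this, ih]
    refine ⟨⟨mk fun m => coeff m (x m).1, ?_⟩, fun n => ?_⟩
    · rw [← coeff_zero_eq_constantCoeff_apply, coeff_mk, coeff_zero_eq_constantCoeff_apply,
        (x 0).2]
    · rw [X_pow_dvd_iff]
      intro m hm
      rw [map_sub, coeff_mk, key m n (Nat.lt_succ_iff.mp hm), sub_self]
  · have h1 := X_pow_dvd_familySum_sub (K := K) (X_pow_dvd_sysTerm hh V.2 c) (n + 1)
    have h2 := X_pow_dvd_familySum_sub (K := K) (X_pow_dvd_sysTerm hh W.2 c) (n + 1)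
    have h3 := X_pow_dvd_partialSum_sub (K := K) hh V.2 W.2 c H
    rw [← ha] at h3
    have h4 := (dvd_add (dvd_sub h1 h2) h3).mul_left (C u)
    refine h4.trans (dvd_of_eq ?_)
    change _ = C u * (familySum K (sysTerm h c V.1) - C a * V.1)
      - C u * (familySum K (sysTerm h c W.1) - C a * W.1)
    ring

lemma isStar_iff {K : Set ℕ} {b : ℕ → ℕ → S} {p : PowerSeries S} :
    IsStar K b p ↔ IsSysSol K X (fun k j => -b k j) p := by
  refine and_congr_right fun hp => ?_
  rw [← isFormalSum_iff (X_pow_dvd_sysTerm constantCoeff_X hp _)]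
  simp only [IsFormalSum, sysTerm, map_neg, neg_mul, ← sub_eq_add_neg]

lemma constantCoeff_neg_X : constantCoeff (-X : PowerSeries S) = 0 := by simp

lemma isCoStar_iff {K : Set ℕ} {l : S} {b : ℕ → ℕ → S} {q : PowerSeries S} :
    IsCoStar K l b q ↔ IsSysSol K (-X) (fun k j => l - b k j) q := by
  refine and_congr_right fun hq => ?_
  rw [← isFormalSum_iff (X_pow_dvd_sysTerm constantCoeff_neg_X hq _)]
  rfl

/-! ### Substitution -/

/-- Substitution of a power series without constant term as a ring homomorphism. -/
noncomputable def substRingHom {g : PowerSeries S} (hg : constantCoeff g = 0) :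
    PowerSeries S →+* PowerSeries S :=
  (substAlgHom (R := S) (S := S) (HasSubst.of_constantCoeff_zero' hg)).toRingHom

lemma substRingHom_apply {g : PowerSeries S} (hg : constantCoeff g = 0) (f : PowerSeries S) :
    substRingHom hg f = f.subst g :=
  congrFun (coe_substAlgHom (HasSubst.of_constantCoeff_zero' hg)) f

lemma substRingHom_X {g : PowerSeries S} (hg : constantCoeff g = 0) : substRingHom hg X = g := by
  rw [substRingHom_apply, subst_X (HasSubst.of_constantCoeff_zero' hg)]

lemma substRingHom_C {g : PowerSeries S} (hg : constantCoeff g = 0) (r : S) :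
    substRingHom hg (C r) = C r := by
  rw [substRingHom_apply, subst_C]
  rfl

lemma X_pow_dvd_substRingHom {g : PowerSeries S} (hg : constantCoeff g = 0) {n : ℕ}
    {f : PowerSeries S} (hf : X ^ n ∣ f) : X ^ n ∣ substRingHom hg f := by
  obtain ⟨f, rfl⟩ := hf
  rw [map_mul, map_pow, substRingHom_X]
  exact (pow_dvd_pow_of_dvd (X_dvd_iff.mpr hg) n).mul_right _

lemma constantCoeff_substRingHom {g : PowerSeries S} (hg : constantCoeff g = 0)
    {f : PowerSeries S} (hf : constantCoeff f = 0) : constantCoeff (substRingHom hg f) = 0 := by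
  rw [← X_dvd_iff, ← pow_one X] at hf ⊢
  exact X_pow_dvd_substRingHom hg hf

/-- Substitution respects the partial sums and preserves divisibility by powers of `X`, hence
carries the whole equation along. -/
lemma IsSysSol.subst {K : Set ℕ} {h W g : PowerSeries S} {c : ℕ → ℕ → S}
    (hh : constantCoeff h = 0) (hW : IsSysSol K h c W) (hg : constantCoeff g = 0) :
    IsSysSol K (substRingHom hg h) c (substRingHom hg W) := by
  refine ⟨constantCoeff_substRingHom hg hW.1, familySum_eq_of_X_pow_dvd (X_pow_dvd_sysTerm
    (constantCoeff_substRingHom hg hh) (constantCoeff_substRingHom hg hW.1) c) fun n => ?_⟩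
  have h1 := X_pow_dvd_substRingHom hg
    (X_pow_dvd_familySum_sub (K := K) (X_pow_dvd_sysTerm hh hW.1 c) n)
  rw [hW.2, map_sub] at h1
  convert h1 using 2
  simp only [partialSum, sysTerm, map_sum, map_prod, map_add, map_mul, substRingHom_C]

lemma IsSysSol.shift {K : Set ℕ} {h W : PowerSeries S} {c : ℕ → ℕ → S} (l : S)
    (hW : IsSysSol K h (fun k j => l + c k j) W) : IsSysSol K (h + C l * W) c W := by
  refine ⟨hW.1, ?_⟩
  conv_rhs => rw [← hW.2]
  congr 1
  funext k
  simp only [sysTerm, map_add]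
  exact Finset.prod_congr rfl fun j _ => by ring

lemma constantCoeff_starTotal (l : S) {p : PowerSeries S} (hp : constantCoeff p = 0) :
    constantCoeff (starTotal l p) = 0 := by
  simp [starTotal, hp]

lemma substRingHom_starTotal {g : PowerSeries S} (hg : constantCoeff g = 0) (l : S)
    (p : PowerSeries S) : substRingHom hg (starTotal l p) = -g + C l * substRingHom hg p := by
  rw [starTotal, map_add, map_neg, map_mul, substRingHom_X, substRingHom_C]

theorem areCompInverse_starTotal {K : Set ℕ} {l : S} {b : ℕ → ℕ → S} (hK : StarSolvable K l b)
    {p q : PowerSeries S} (hp : IsStar K b p) (hq : IsCoStar K l b q) :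
    AreCompInverse (starTotal l p) (starTotal l q) := by
  rw [isStar_iff] at hp
  rw [isCoStar_iff] at hq
  have hp0 := constantCoeff_starTotal l hp.1
  have hq0 := constantCoeff_starTotal l hq.1
  refine ⟨hp0, hq0, ?_, ?_⟩
  · have h1 := hp.subst constantCoeff_X hq0
    rw [substRingHom_X] at h1
    have h2 : IsSysSol K (starTotal l q) (fun k j => -b k j) q :=
      IsSysSol.shift l (by simpa only [← sub_eq_add_neg] using hq)
    have h3 := (existsUnique_isSysSol hK.1 hq0 fun h => by
      simpa using (hK.2 h).1).unique h1 h2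
    rw [← substRingHom_apply hq0, substRingHom_starTotal, h3, starTotal]
    ring
  · have h1 := hq.subst constantCoeff_neg_X hp0
    rw [map_neg, substRingHom_X] at h1
    -- Here `-starTotal l p = X - l p`, and shifting the coefficients by `-l` turns `l - b k j` into
    -- `-b k j`.
    have h2 : IsSysSol K (-starTotal l p) (fun k j => l - b k j) p := by
      have h4 : -starTotal l p = X + C (-l) * p := by
        rw [starTotal, map_neg]
        ring
      rw [h4]
      refine IsSysSol.shift (-l) ?_
      convert hp using 3
      ring
    have h3 := (existsUnique_isSysSol hK.1 (by rw [map_neg, hp0, neg_zero]) fun h => by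
      simpa [sub_sub_eq_add_sub] using (hK.2 h).2).unique h1 h2
    rw [← substRingHom_apply hp0, substRingHom_starTotal, h3, starTotal]
    ring

/-! ### Compositional inverses -/

lemma rescale_eq_substRingHom (a : S) (f : PowerSeries S) :
    rescale a f = substRingHom (g := C a * X) (by simp) f := by
  rw [rescale_eq_subst, substRingHom_apply, smul_eq_C_mul]

lemma substRingHom_substRingHom {a b : PowerSeries S} (ha : constantCoeff a = 0)
    (hb : constantCoeff b = 0) (f : PowerSeries S) : substRingHom hb (substRingHom ha f)
      = substRingHom (constantCoeff_substRingHom hb ha) f := by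
  simp only [substRingHom_apply]
  exact subst_comp_subst_apply (HasSubst.of_constantCoeff_zero' ha)
    (HasSubst.of_constantCoeff_zero' hb) f

theorem AreCompInverse.of_rescale {h g' : PowerSeries S} (u : Sˣ) (h0 : constantCoeff h = 0)
    (H : AreCompInverse (rescale (u : S) h) g') : AreCompInverse h (C (u : S) * g') := by
  obtain ⟨hg, hg', h1, h2⟩ := H
  have hu : constantCoeff (C (u : S) * g') = 0 := by simp [hg']
  refine ⟨h0, hu, ?_, ?_⟩
  · rw [← substRingHom_apply hg', rescale_eq_substRingHom, substRingHom_substRingHom,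
      substRingHom_apply, map_mul, substRingHom_C, substRingHom_X] at h1
    exact h1
  -- Replacing `X` by `u⁻¹ X` in `g'(h(uX)) = X` gives `g'(h(X)) = u⁻¹ X`.
  · have h3 := congrArg (rescale (↑u⁻¹ : S)) h2
    rw [← substRingHom_apply hg, rescale_eq_substRingHom, substRingHom_substRingHom,
      substRingHom_apply, ← rescale_eq_substRingHom, rescale_rescale, Units.mul_inv,
      rescale_one, RingHom.id_apply, rescale_X] at h3
    rw [← substRingHom_apply h0, map_mul, substRingHom_C, substRingHom_apply, h3, ← mul_assoc,
      ← map_mul, Units.mul_inv, map_one, one_mul]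

/-- If only `b k 1` may be non-zero, the `k`-th product is `X ^ k - b k 1 * X ^ (k - 1) * p`, so the
equation is linear in the parameters: `p (1 + D) = X ^ m / (1 - X)`. Writing `p = X ^ m v` with `v`
invertible determines `D`. -/
theorem exists_isStar {m : ℕ} (hm : m = 1 ∨ m = 2) {p : PowerSeries S}
    (hp : X ^ m ∣ p) (hp1 : coeff m p = 1) : ∃ b : ℕ → ℕ → S, b 1 1 = 0 ∧
      IsStar {k | m ≤ k} b p := by
  classical
  have hp0 : constantCoeff p = 0 := by
    rw [← X_dvd_iff]
    exact (dvd_pow_self _ (by omega)).trans hp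
  obtain ⟨v, rfl⟩ := hp
  have hv : constantCoeff v = 1 := by
    rwa [coeff_X_pow_mul', if_pos le_rfl, Nat.sub_self, coeff_zero_eq_constantCoeff_apply] at hp1
  obtain ⟨v', hv'⟩ : ∃ v', v * v' = 1 :=
    (isUnit_iff_constantCoeff.mpr (hv ▸ isUnit_one)).exists_right_inv
  have hv'0 : constantCoeff v' = 1 := by
    have := congrArg constantCoeff hv'
    rwa [map_mul, hv, one_mul, map_one] at this
  -- The series `e` is `1 / (1 - X)`; both `e` and `v'` have constant term 1, so `D` has none.
  let e : PowerSeries S := mk 1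
  let D := e * v' - 1
  have hD0 : coeff 0 D = 0 := by simp [D, e, hv'0]
  let b : ℕ → ℕ → S := fun k j => if j = 1 then coeff (k - 1) D else 0
  refine ⟨b, hD0, hp0, ?_⟩
  set p := X ^ m * v with hpdef
  let F : ℕ → PowerSeries S := fun k => ∏ j ∈ Finset.Icc 1 k, (X - C (b k j) * p)
  have hF : ∀ k, X ^ k ∣ F k := fun k => by
    simpa [sysTerm, F, ← sub_eq_add_neg] using
      X_pow_dvd_sysTerm constantCoeff_X hp0 (fun k j => -b k j) k
  have hFk : ∀ k, m ≤ k → F k = X ^ k - C (coeff (k - 1) D) * X ^ (k - 1) * p := by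
    intro k hk
    obtain ⟨k, rfl⟩ : ∃ k', k = k' + 1 := ⟨k - 1, by omega⟩
    have h1 : ∀ j ∈ Finset.Icc 1 (k + 1), j ≠ 1 → X - C (b (k + 1) j) * p = X := by
      intro j _ hj
      simp [b, hj]
    simp only [F]
    rw [← Finset.mul_prod_erase _ _ (Finset.mem_Icc.mpr ⟨le_rfl, by omega⟩),
      Finset.prod_congr rfl fun j hj => h1 j (Finset.mem_of_mem_erase hj) (Finset.ne_of_mem_erase hj),
      Finset.prod_const, Finset.card_erase_of_mem (Finset.mem_Icc.mpr ⟨le_rfl, by omega⟩),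
      Nat.card_Icc]
    simp only [b, if_true, Nat.add_sub_cancel]
    ring
  refine (isFormalSum_iff hF p).mpr (familySum_eq_of_X_pow_dvd hF fun n => ?_)
  let s := (Finset.range (n + 1)).filter (· ∈ {k | m ≤ k})
  have hs : ∀ k, k ∈ s ↔ k ≤ n ∧ m ≤ k := fun k => by simp [s]
  have hsum : partialSum {k | m ≤ k} F n
      = ∑ k ∈ s, X ^ k - (∑ k ∈ s, C (coeff (k - 1) D) * X ^ (k - 1)) * p := by
    rw [Finset.sum_mul, ← Finset.sum_sub_distrib, partialSum]
    refine Finset.sum_congr (by ext; simp [s]) fun k hk => hFk k ((hs k).mp hk).2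
  have hQ : X ^ (n + 1) ∣ X ^ m * e - ∑ k ∈ s, X ^ k := by
    rw [X_pow_dvd_iff]
    intro j hj
    rw [map_sub, map_sum, coeff_X_pow_mul']
    simp only [coeff_X_pow, Finset.sum_ite_eq, hs, e, coeff_mk, Pi.one_apply,
      Nat.lt_succ_iff.mp hj, true_and, sub_self]
  have hT : X ^ n ∣ ∑ k ∈ s, C (coeff (k - 1) D) * X ^ (k - 1) - D := by
    rw [X_pow_dvd_iff]
    intro j hj
    rw [map_sub, map_sum, sub_eq_zero]
    simp only [coeff_C_mul, coeff_X_pow]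
    by_cases hmj : m ≤ j + 1
    · rw [Finset.sum_eq_single (j + 1)]
      · simp
      · intro k hk hkj
        have := (hs k).mp hk
        rw [if_neg (by omega), mul_zero]
      · intro hcon
        exact absurd ((hs _).mpr ⟨hj, hmj⟩) hcon
    -- For `m = 2` the sum lacks the index `k = 1`, which is harmless because `D` has no constant
    -- term.
    · obtain rfl : j = 0 := by omega
      rw [hD0]
      refine Finset.sum_eq_zero fun k hk => ?_
      have := (hs k).mp hk
      rw [if_neg (by omega), mul_zero]
  have hpD : p * (1 + D) = X ^ m * e := by
    simp only [hpdef, D]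
    linear_combination X ^ m * e * hv'
  -- The truncation of `D` is exact only modulo `X ^ n`; the factor `p` supplies the missing power.
  have h2 := mul_dvd_mul (X_dvd_iff.mpr hp0) hT
  rw [← pow_succ'] at h2
  have h3 := dvd_add hQ h2
  refine h3.trans (dvd_of_eq ?_)
  rw [hsum]
  linear_combination -hpD

lemma constantCoeff_rescale {h : PowerSeries S} (h0 : constantCoeff h = 0) (a : S) :
    constantCoeff (rescale a h) = 0 := by
  rw [← coeff_zero_eq_constantCoeff_apply, coeff_rescale, coeff_zero_eq_constantCoeff_apply, h0,
    mul_zero]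

/-- A series `f = -X + l p` with `p = X^m + ⋯`, `m = 1` or `m = 2`. -/
theorem exists_isStar_starTotal {m : ℕ} (hm : m = 1 ∨ m = 2) {f : PowerSeries S} {l : S}
    (hl : IsUnit l) (hf : X ^ m ∣ f + X) (hf1 : coeff m (f + X) = l) :
    ∃ (b : ℕ → ℕ → S) (p : PowerSeries S), b 1 1 = 0 ∧ IsStar {k | m ≤ k} b p ∧
      f = starTotal l p := by
  obtain ⟨l', hl'⟩ := hl.exists_right_inv
  obtain ⟨b, hb, hp⟩ := exists_isStar hm (p := C l' * (f + X)) (hf.mul_left _)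
    (by rw [coeff_C_mul, hf1, mul_comm, hl'])
  refine ⟨b, _, hb, hp, ?_⟩
  rw [starTotal, ← mul_assoc, ← map_mul, hl', map_one, one_mul]
  ring

end PowerSeries

/-! ### Assembly of the three parts -/

theorem mainTheorem2 :
    (∀ (R : Type*) [Ring R] (A : Type*) (K : Set ℕ) (_hK : ∀ k ∈ K, 0 < k)
      (part : K → Set A) (_hne : ∀ k, (part k).Nonempty)
      (_hdisj : Pairwise fun k k' => Disjoint (part k) (part k'))
      (_hcover : ⋃ k, part k = Set.univ)
      (M : (k : K) → Fin k → Matrix (part k) A R),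
      (∃! V : A → NCSeries R A, NCSeries.IsDirectSystem M V) ∧
      (∃! V' : A → NCSeries R A, NCSeries.IsComplementarySystem M V') ∧
      ∀ V V' : A → NCSeries R A,
        NCSeries.IsDirectSystem M V → NCSeries.IsComplementarySystem M V' →
        NCSeries.comp (NCSeries.total V) (NCSeries.total V') = NCSeries.X ∧
        NCSeries.comp (NCSeries.total V') (NCSeries.total V) = NCSeries.X) ∧
    (∀ (S : Type*) [CommRing S],
      (∀ (K : Set ℕ) (l : S) (b : ℕ → ℕ → S), StarSolvable K l b →
        (∃! p, IsStar K b p) ∧ (∃! q, IsCoStar K l b q) ∧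
        ∀ p q, IsStar K b p → IsCoStar K l b q →
          AreCompInverse (starTotal l p) (starTotal l q)) ∧
      (∀ (h : PowerSeries S) (u : Sˣ), PowerSeries.constantCoeff h = 0 →
        (∀ (K : Set ℕ) (l : S) (b : ℕ → ℕ → S) (p q : PowerSeries S), StarSolvable K l b →
          IsStar K b p → IsCoStar K l b q →
          PowerSeries.rescale (u : S) h = starTotal l p →
          AreCompInverse h (PowerSeries.C (u : S) * starTotal l q)) ∧
        (u * PowerSeries.coeff 1 h = -1 → IsUnit (PowerSeries.coeff 2 h) →
          ∃ (b : ℕ → ℕ → S) (p : PowerSeries S), IsStar {k | 2 ≤ k} b p ∧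
            PowerSeries.rescale (u : S) h
              = starTotal (PowerSeries.coeff 2 (PowerSeries.rescale (u : S) h)) p) ∧
        (IsUnit (PowerSeries.coeff 1 h) → IsUnit (1 + u * PowerSeries.coeff 1 h) →
          ∃ (l : S) (b : ℕ → ℕ → S) (p : PowerSeries S), StarSolvable {k | 1 ≤ k} l b ∧
            IsStar {k | 1 ≤ k} b p ∧
            PowerSeries.rescale (u : S) h = starTotal l p))) := by
  refine ⟨fun R _ A K hK part _ hdisj hcover M =>
    NCSeries.directSystem_comp_complementarySystem hK hdisj hcover M, fun S _ =>
    ⟨fun K l b hK => ⟨?_, ?_, fun p q hp hq => PowerSeries.areCompInverse_starTotal hK hp hq⟩,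
    fun h u h0 => ⟨fun K l b p q hK hp hq e => ?_, fun h1 h2 => ?_, fun h1 h2 => ?_⟩⟩⟩
  · simp only [PowerSeries.isStar_iff]
    exact PowerSeries.existsUnique_isSysSol hK.1 PowerSeries.constantCoeff_X fun h => by
      simpa using (hK.2 h).1
  · simp only [PowerSeries.isCoStar_iff]
    exact PowerSeries.existsUnique_isSysSol hK.1 PowerSeries.constantCoeff_neg_X fun h => by
      simpa [sub_sub_eq_add_sub] using (hK.2 h).2
  · exact PowerSeries.AreCompInverse.of_rescale u h0
      (e ▸ PowerSeries.areCompInverse_starTotal hK hp hq)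
  · have hl : IsUnit (PowerSeries.coeff 2 (PowerSeries.rescale (u : S) h)) := by
      rw [PowerSeries.coeff_rescale]
      exact (u.isUnit.pow 2).mul h2
    obtain ⟨b, p, -, hp, e⟩ := PowerSeries.exists_isStar_starTotal (m := 2) (Or.inr rfl)
      (f := PowerSeries.rescale (u : S) h) hl
      (by
        rw [PowerSeries.X_pow_dvd_iff]
        intro j hj
        interval_cases j
        · simp [PowerSeries.constantCoeff_rescale h0]
        · simp [PowerSeries.coeff_rescale, h1])
      (by simp [PowerSeries.coeff_X])
    exact ⟨b, p, hp, e⟩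
  · obtain ⟨b, p, hb, hp, e⟩ := PowerSeries.exists_isStar_starTotal (m := 1) (Or.inl rfl)
      (f := PowerSeries.rescale (u : S) h) h2
      (by rw [pow_one, PowerSeries.X_dvd_iff]; simp [PowerSeries.constantCoeff_rescale h0])
      (by simp [PowerSeries.coeff_rescale, add_comm])
    -- Here `l = 1 + u γ₁` and `b 1 1 = 0`, so the two elements to be inverted are `1` and `-u γ₁`.
    refine ⟨_, b, p, ⟨fun k hk => hk, fun _ => ?_⟩, hp, e⟩
    rw [hb]
    refine ⟨by simp, ?_⟩
    simpa using u.isUnit.mul h1
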